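/- Let $\mathcal V$ be a countably infinite set of qubit variables. For a finite $V\subseteq\mathcal V$ let $\mathcal H_V=\bigotimes_{q\in V}\mathbb C^2$. Let $\mathcal D(\mathcal H_V)$ be the set of positive operators on $\mathcal H_V$ with trace at most $1$, and $\mathcal P(\mathcal H_V)$ the set of effects, i.e. operators $M$ with $0\sqsubseteq M\sqsubseteq I$ (Löwner order). Let $\mathrm{DProg}(V)$ be the set of completely positive trace-nonincreasing super-operators on $\mathcal H_V$, and $\mathrm{NProg}(V)$ the set of nonempty, convex and closed subsets of $\mathrm{DProg}(V)$. Operators and super-operators on a subsystem are extended to larger systems by tensoring with the identity. For a finite $W\subseteq\mathcal V$, a specification on $W$ is a pair $(\Theta,\Psi)$ of sets of effects on $\mathcal H_W$. Put $\mathrm{Exp}(\rho\models\Theta)=\inf_{M\in\Theta}\operatorname{tr}(M\rho)$, with the convention that this is $\operatorname{tr}\rho$ if $\Theta=\emptyset$. A program $\mathbb E\in\mathrm{NProg}(V)$ satisfies $(\Theta,\Psi)$ in total correctness, written $\mathbb E\models_{\rm tot}(\Theta,\Psi)$, if for every finite $X\supseteq V\cup W$ and every $\rho\in\mathcal D(\mathcal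 H_X)$, $$\mathrm{Exp}(\rho\models\Theta)\le\inf_{\mathcal E\in\mathbb E}\mathrm{Exp}(\mathcal E(\rho)\models\Psi).$$ It satisfies $(\Theta,\Psi)$ in partial correctness, written $\mathbb E\models_{\rm par}(\Theta,\Psi)$, if for all such $X$ and $\rho$ $$\mathrm{Exp}(\rho\models\Theta)\le\inf_{\mathcal E\in\mathbb E}\bigl(\mathrm{Exp}(\mathcal E(\rho)\models\Psi)+\operatorname{tr}\rho-\operatorname{tr}\mathcal E(\rho)\bigr).$$ Write $\mathbb E\le_T^s\mathbb F$ (resp. $\mathbb E\le_P^s\mathbb F$) if, for every finite $W\subseteq\mathcal V$, every specification on $W$ that $\mathbb E$ satisfies in total (resp. partial) correctness is also satisfied by $\mathbb F$ in total (resp. partial) correctness. The adjoint $\mathcal E^\dagger$ is defined by $\operatorname{tr}(\mathcal E(A)B)=\operatorname{tr}(A\,\mathcal E^\dagger(B))$ for all $A,B$. Put $\mathbb E^\dagger(\Psi)=\{\mathcal E^\dagger(N):\mathcal E\in\mathbb E,\,N\in\Psi\}$ and $I-\Psi=\{I-N:N\in\Psi\}$. Let $$wp^s.\mathbb E.\Psi=\mathbb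 E^\dagger(\Psi),\qquad wlp^s.\mathbb E.\Psi=I-\mathbb E^\dagger(I-\Psi).$$ **Theorem.** Let $V,V'\subseteq\mathcal V$ be finite and disjoint with $|V'|=|V|$, and let $d=2^{|V|}$. Let $\{|i\rangle_V\}_{i<d}$ and $\{|i\rangle_{V'}\}_{i<d}$ be orthonormal bases of $\mathcal H_V$ and $\mathcal H_{V'}$, and let $\Omega=|\omega\rangle\langle\omega|$ with $|\omega\rangle=\frac1{\sqrt d}\sum_{i<d}|i\rangle_V|i\rangle_{V'}$ be the maximally entangled state on $\mathcal H_{V\cup V'}$. Then for all $\mathbb E,\mathbb F\in\mathrm{NProg}(V)$: 1. $(wp^s.\mathbb E.\{\Omega\},\{\Omega\})$ is a specification on $V\cup V'$, and $\mathbb E\le_T^s\mathbb F$ if and only if $\mathbb F\models_{\rm tot}(wp^s.\mathbb E.\{\Omega\},\{\Omega\})$; 2. $(wlp^s.\mathbb E.\{I-\Omega\},\{I-\Omega\})$ is a specification on $V\cup V'$, and $\mathbb E\le_P^s\mathbb F$ if and only if $\mathbb F\models_{\rm par}(wlp^s.\mathbb E.\{I-\Omega\},\{I-\Omega\})$. 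-/

import Mathlib

open scoped ComplexOrder Kronecker

namespace QRefine

noncomputable section

/-- Computational basis labels of `H_V = ⨂_{q ∈ V} ℂ²` for a finite set `V` of qubit variables. -/
abbrev Idx {𝒱 : Type*} (V : Finset 𝒱) : Type _ := V → Fin 2

/-- The Hilbert space `H_V`, of dimension `2 ^ |V|`. -/
abbrev HSpace {𝒱 : Type*} (V : Finset 𝒱) : Type _ := EuclideanSpace ℂ (Idx V)

/-- Linear operators on `H_V`, as matrices in the computational basis. -/
abbrev Op {𝒱 : Type*} (V : Finset 𝒱) : Type _ := Matrix (Idx V) (Idx V) ℂ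

/-- Super-operators on `H_V`. -/
abbrev SuperOp {𝒱 : Type*} (V : Finset 𝒱) : Type _ := Op V →ₗ[ℂ] Op V

section General

variable {m n a : Type*}

/-- `I_H ⊗ 𝓔`, where `H` has orthonormal basis labelled by `a`: apply `𝓔` to every block. -/
def idTensor (a : Type*) (E : Matrix m m ℂ →ₗ[ℂ] Matrix n n ℂ) :
    Matrix (a × m) (a × m) ℂ →ₗ[ℂ] Matrix (a × n) (a × n) ℂ where
  toFun M := Matrix.of fun p q => E (Matrix.of fun i j => M (p.1, i) (q.1, j)) p.2 q.2
  map_add' M N := by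
    ext p q
    exact congrFun (congrFun (E.map_add (Matrix.of fun i j => M (p.1, i) (q.1, j))
      (Matrix.of fun i j => N (p.1, i) (q.1, j))) p.2) q.2
  map_smul' c M := by
    ext p q
    exact congrFun (congrFun (E.map_smul c (Matrix.of fun i j => M (p.1, i) (q.1, j))) p.2) q.2

/-- The defining property `(I_H ⊗ 𝓔)(A ⊗ B) = A ⊗ 𝓔(B)`. -/
theorem idTensor_kronecker (E : Matrix m m ℂ →ₗ[ℂ] Matrix n n ℂ)
    (A : Matrix a a ℂ) (B : Matrix m m ℂ) : idTensor a E (A ⊗ₖ B) = A ⊗ₖ E B := by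
  ext p q
  exact congrFun (congrFun (E.map_smul (A p.1 q.1) B) p.2) q.2

/-- `𝓔` is completely positive: `I_H ⊗ 𝓔` is positive for every finite-dimensional `H`. -/
def IsCompletelyPositive (E : Matrix m m ℂ →ₗ[ℂ] Matrix n n ℂ) : Prop :=
  ∀ (k : ℕ) (M : Matrix (Fin k × m) (Fin k × m) ℂ),
    M.PosSemidef → (idTensor (Fin k) E M).PosSemidef

/-- `tr 𝓔(A) ≤ tr A` for every positive `A`. -/
def IsTraceNonincreasing [Fintype m] [Fintype n]
    (E : Matrix m m ℂ →ₗ[ℂ] Matrix n n ℂ) : Prop :=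
  ∀ A : Matrix m m ℂ, A.PosSemidef → (E A).trace.re ≤ A.trace.re

/-- The adjoint super-operator `𝓔†`, characterised by `tr (𝓔(A) B) = tr (A 𝓔†(B))`. -/
def adjointSuper [Fintype n] [DecidableEq m] (E : Matrix m m ℂ →ₗ[ℂ] Matrix n n ℂ) :
    Matrix n n ℂ →ₗ[ℂ] Matrix m m ℂ where
  toFun B := Matrix.of fun i j => (E (Matrix.single j i 1) * B).trace
  map_add' B C := by ext i j; simp [Matrix.mul_add]
  map_smul' c B := by ext i j; simp

theorem trace_mul_adjointSuper [Fintype m] [Fintype n] [DecidableEq m]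
    (E : Matrix m m ℂ →ₗ[ℂ] Matrix n n ℂ) (A : Matrix m m ℂ) (B : Matrix n n ℂ) :
    (E A * B).trace = (A * adjointSuper E B).trace := by
  conv_lhs => rw [Matrix.matrix_eq_sum_single A]
  simp only [map_sum, Finset.sum_mul, Matrix.trace_sum]
  simp only [Matrix.trace, Matrix.diag, Matrix.mul_apply (M := A)]
  refine Finset.sum_congr rfl fun i _ => Finset.sum_congr rfl fun j _ => ?_
  have h : Matrix.single i j (A i j) = A i j • Matrix.single i j (1 : ℂ) := by simp
  rw [h, map_smul]
  simp [adjointSuper, Matrix.trace, Finset.mul_sum]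

end General

variable {𝒱 : Type*} [DecidableEq 𝒱]

/-- `H_X = H_{X \ V} ⊗ H_V` on basis labels, for `V ⊆ X`. -/
def splitEquiv {V X : Finset 𝒱} (h : V ⊆ X) : Idx X ≃ Idx (X \ V) × Idx V where
  toFun x := (fun q => x ⟨q, Finset.sdiff_subset q.2⟩, fun q => x ⟨q, h q.2⟩)
  invFun p q := if hq : q.1 ∈ V then p.2 ⟨q, hq⟩
    else p.1 ⟨q, Finset.mem_sdiff.2 ⟨q.2, hq⟩⟩
  left_inv x := by ext q; by_cases hq : q.1 ∈ V <;> simp [hq]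
  right_inv p := by
    refine Prod.ext (funext fun q => ?_) (funext fun q => ?_)
    · simp [(Finset.mem_sdiff.1 q.2).2]
    · simp

/-- `I_{X \ W} ⊗ N`, for `W ⊆ X`. -/
def extendOp {W X : Finset 𝒱} (h : W ⊆ X) (N : Op W) : Op X :=
  ((1 : Op (X \ W)) ⊗ₖ N).submatrix (splitEquiv h) (splitEquiv h)

/-- `I_{X \ V} ⊗ 𝓔`, for `V ⊆ X`. -/
def extendSuper {V X : Finset 𝒱} (h : V ⊆ X) (E : SuperOp V) : SuperOp X :=
  (Matrix.reindexLinearEquiv ℂ ℂ (splitEquiv h) (splitEquiv h)).symm.toLinearMap ∘ₗ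
    idTensor (Idx (X \ V)) E ∘ₗ
      (Matrix.reindexLinearEquiv ℂ ℂ (splitEquiv h) (splitEquiv h)).toLinearMap

/-- Partial density operators on `H_V`. -/
def States (V : Finset 𝒱) : Set (Op V) := {ρ | ρ.PosSemidef ∧ ρ.trace.re ≤ 1}

/-- Effects on `H_V`: operators `M` with `0 ⊑ M ⊑ I`. -/
def Effects (V : Finset 𝒱) : Set (Op V) := {M | M.PosSemidef ∧ (1 - M).PosSemidef}

/-- Deterministic programs: completely positive trace-nonincreasing super-operators. -/
def DProg (V : Finset 𝒱) : Set (SuperOp V) :=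
  {E | IsCompletelyPositive E ∧ IsTraceNonincreasing E}

/-- Nondeterministic programs: nonempty, convex and closed sets of deterministic programs
(closed in the Euclidean topology, i.e. for the matrix entries of the super-operators). -/
structure IsNProg (V : Finset 𝒱) (𝔼 : Set (SuperOp V)) : Prop where
  subset : 𝔼 ⊆ DProg V
  nonempty : 𝔼.Nonempty
  convex : Convex ℝ 𝔼
  closed : IsClosed (LinearMap.toMatrix (Matrix.stdBasis ℂ (Idx V) (Idx V))
    (Matrix.stdBasis ℂ (Idx V) (Idx V)) '' 𝔼)

/-- Specifications: pairs (precondition, postcondition) of sets of effects on `H_W`. -/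
def SpecS (W : Finset 𝒱) : Set (Set (Op W) × Set (Op W)) :=
  {S | S.1 ⊆ Effects W ∧ S.2 ⊆ Effects W}

open Classical in
/-- Demonic satisfaction `inf_{M ∈ Θ} tr (M ρ)`, where `M` stands for `I_{X \ W} ⊗ M`;
by convention it is `tr ρ` for `Θ = ∅`. -/
def expDem {W X : Finset 𝒱} (h : W ⊆ X) (ρ : Op X) (Θ : Set (Op W)) : ℝ :=
  if Θ = ∅ then ρ.trace.re else sInf ((fun M => (extendOp h M * ρ).trace.re) '' Θ)

/-- `𝔼(ρ) = {𝓔(ρ) : 𝓔 ∈ 𝔼}` for a state `ρ` of a larger system `X ⊇ V`. -/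
def outputs {V X : Finset 𝒱} (h : V ⊆ X) (𝔼 : Set (SuperOp V)) (ρ : Op X) : Set (Op X) :=
  (fun E => extendSuper h E ρ) '' 𝔼

/-- Total correctness `𝔼 ⊨_tot (Θ, Ψ)`. -/
def SatTot {V W : Finset 𝒱} (𝔼 : Set (SuperOp V)) (S : Set (Op W) × Set (Op W)) : Prop :=
  ∀ (X : Finset 𝒱) (hV : V ⊆ X) (hW : W ⊆ X), ∀ ρ ∈ States X,
    expDem hW ρ S.1 ≤ sInf ((fun σ => expDem hW σ S.2) '' outputs hV 𝔼 ρ)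

/-- Partial correctness `𝔼 ⊨_par (Θ, Ψ)`. -/
def SatPar {V W : Finset 𝒱} (𝔼 : Set (SuperOp V)) (S : Set (Op W) × Set (Op W)) : Prop :=
  ∀ (X : Finset 𝒱) (hV : V ⊆ X) (hW : W ⊆ X), ∀ ρ ∈ States X,
    expDem hW ρ S.1 ≤
      sInf ((fun σ => expDem hW σ S.2 + ρ.trace.re - σ.trace.re) '' outputs hV 𝔼 ρ)

/-- `𝔼 ≤_T^s 𝔽`. -/
def RefinesTot {V : Finset 𝒱} (𝔼 𝔽 : Set (SuperOp V)) : Prop :=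
  ∀ (W : Finset 𝒱), ∀ S ∈ SpecS W, SatTot 𝔼 S → SatTot 𝔽 S

/-- `𝔼 ≤_P^s 𝔽`. -/
def RefinesPar {V : Finset 𝒱} (𝔼 𝔽 : Set (SuperOp V)) : Prop :=
  ∀ (W : Finset 𝒱), ∀ S ∈ SpecS W, SatPar 𝔼 S → SatPar 𝔽 S

/-- `I - Θ = {I - M : M ∈ Θ}`. -/
def oneMinus {W : Finset 𝒱} (Θ : Set (Op W)) : Set (Op W) := (fun M => 1 - M) '' Θ

/-- `𝔼†(Ψ) = {𝓔†(N) : 𝓔 ∈ 𝔼, N ∈ Ψ}`, for sets `Ψ` of operators on `H_W` with `V ⊆ W`. -/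
def adjointSet {V W : Finset 𝒱} (h : V ⊆ W) (𝔼 : Set (SuperOp V)) (Ψ : Set (Op W)) :
    Set (Op W) :=
  Set.image2 (fun E N => adjointSuper (extendSuper h E) N) 𝔼 Ψ

/-- Weakest precondition `wp^s.𝔼.Ψ = 𝔼†(Ψ)`. -/
def wp {V W : Finset 𝒱} (h : V ⊆ W) (𝔼 : Set (SuperOp V)) (Ψ : Set (Op W)) : Set (Op W) :=
  adjointSet h 𝔼 Ψ

/-- Weakest liberal precondition `wlp^s.𝔼.Ψ = I - 𝔼†(I - Ψ)`. -/
def wlp {V W : Finset 𝒱} (h : V ⊆ W) (𝔼 : Set (SuperOp V)) (Ψ : Set (Op W)) : Set (Op W) :=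
  oneMinus (adjointSet h 𝔼 (oneMinus Ψ))

/-- `V' ‖ V`: `V'` is a disjoint copy of `V`. -/
def IsDisjointCopy (V' V : Finset 𝒱) : Prop := V'.card = V.card ∧ Disjoint V V'

/-- `|ω⟩ = d^{-1/2} ∑_i |i⟩_V |i⟩_{V'}` on `H_{V ∪ V'} = H_V ⊗ H_{V'}`, with `d = 2 ^ |V|`,
for given orthonormal bases of `H_V` and `H_{V'}`. -/
def omegaVec {V V' : Finset 𝒱} (b : OrthonormalBasis (Fin (2 ^ V.card)) ℂ (HSpace V))
    (b' : OrthonormalBasis (Fin (2 ^ V.card)) ℂ (HSpace V')) : Idx (V ∪ V') → ℂ := fun x =>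
  ((1 / Real.sqrt (2 ^ V.card) : ℝ) : ℂ) *
    ∑ i, b i (fun q => x ⟨q, Finset.subset_union_left q.2⟩) *
      b' i (fun q => x ⟨q, Finset.subset_union_right q.2⟩)

/-- The maximally entangled state `Ω = |ω⟩⟨ω|`. -/
def Omega {V V' : Finset 𝒱} (b : OrthonormalBasis (Fin (2 ^ V.card)) ℂ (HSpace V))
    (b' : OrthonormalBasis (Fin (2 ^ V.card)) ℂ (HSpace V')) : Op (V ∪ V') :=
  Matrix.vecMulVec (omegaVec b b') (star (omegaVec b b'))

end

end QRefine

open QRefine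

/-! Both refinement orders reduce to comparisons of single super-operators. Total refinement follows
if every `F` in `𝔽` dominates some `E` in `𝔼`, meaning that `F - E` is completely positive, since
demonic expectation is monotone in the output. Partial refinement follows if `E - F` is completely
positive, since expectation minus trace is antitone.

Conversely, `𝔼` satisfies its own weakest-precondition specification by duality, so refinement
passes it to `𝔽`. For fixed `F` this says that, against each state, the infimum over `E` of the
expectation of `E†(Ω)` is at most that of `F†(Ω)`. The `E` depends on the state, but the set of all
`E†(Ω)` is compact and convex, so Hahn–Banach separation (`exists_le_of_forall_state`) gives one `E`
with `E†(Ω) ⊑ F†(Ω)`. In the partial case the inequality is reversed by the complements.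

Finally `(F - E)†(Ω) ⊒ 0` is a Choi-type criterion (`extendSuper_posSemidef_of_adjointSuper_Omega`):
every vector of `H_{X \ V} ⊗ H_V` is `(K ⊗ 1)|ω⟩` for some `K`, and `K` commutes past a map acting
on `V`. So the single effect `Ω` detects complete positivity. -/

namespace QRefine

/-! ### Positive matrices and separation in the Löwner order -/

section MatrixPositivity

variable {n : Type*} [Fintype n]

/-- Over `ℂ` a real-valued quadratic form already forces the matrix to be Hermitian. -/
theorem posSemidef_of_dotProduct_nonneg {A : Matrix n n ℂ}
    (h : ∀ x : n → ℂ, 0 ≤ star x ⬝ᵥ (A.mulVec x)) : A.PosSemidef := by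
  classical
  refine .of_dotProduct_mulVec_nonneg ?_ h
  rw [← Matrix.isSymmetric_toEuclideanLin_iff, LinearMap.isSymmetric_iff_inner_map_self_real]
  intro v
  have h1 := h v.ofLp
  have h2 : inner ℂ (A.toEuclideanLin v) v = star (star v.ofLp ⬝ᵥ (A.mulVec v.ofLp)) := by
    rw [← Matrix.star_dotProduct_star, star_star, dotProduct_comm]
    simp [EuclideanSpace.inner_eq_star_dotProduct]
  rw [h2, (IsSelfAdjoint.of_nonneg h1).star_eq]
  exact (IsSelfAdjoint.of_nonneg h1)

theorem trace_vecMulVec_star_mul (A : Matrix n n ℂ) (x : n → ℂ) :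
    (Matrix.vecMulVec x (star x) * A).trace = star x ⬝ᵥ (A.mulVec x) := by
  rw [Matrix.vecMulVec_mul, Matrix.trace_vecMulVec, Matrix.dotProduct_mulVec, dotProduct_comm]

theorem posSemidef_of_trace_mul_nonneg {A : Matrix n n ℂ}
    (h : ∀ ρ : Matrix n n ℂ, ρ.PosSemidef → 0 ≤ (ρ * A).trace) : A.PosSemidef :=
  posSemidef_of_dotProduct_nonneg fun x => by
    rw [← trace_vecMulVec_star_mul]
    exact h _ (Matrix.posSemidef_vecMulVec_self_star x)

theorem trace_mul_nonneg {A B : Matrix n n ℂ} (hA : A.PosSemidef) (hB : B.PosSemidef) :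
    0 ≤ (A * B).trace := by
  classical
  obtain ⟨C, rfl⟩ : ∃ C : Matrix n n ℂ, A = C.conjTranspose * C := by
    open scoped MatrixOrder in
    exact (CStarAlgebra.nonneg_iff_eq_star_mul_self (a := A)).1 hA.nonneg
  rw [Matrix.mul_assoc, Matrix.trace_mul_comm]
  exact (hB.mul_mul_conjTranspose_same C).trace_nonneg

theorem isClosed_posSemidef : IsClosed {A : Matrix n n ℂ | A.PosSemidef} := by
  simp only [Matrix.posSemidef_iff_dotProduct_mulVec, Set.ofPred_and, Set.ofPred_forall]
  refine IsClosed.inter ?_ (isClosed_iInter fun x => ?_)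
  · exact isClosed_eq (by fun_prop) continuous_id
  · exact isClosed_le continuous_const (by fun_prop)

/-- The 2×2 principal minor gives `|A i j|² ≤ A i i * A j j`, and each diagonal entry is at most the
trace. -/
theorem norm_apply_le_trace {A : Matrix n n ℂ} (hA : A.PosSemidef) (i j : n) :
    ‖A i j‖ ≤ A.trace.re := by
  classical
  have hre : ∀ k, 0 ≤ (A k k).re := fun k => (Complex.le_def.1 hA.diag_nonneg).1
  have him : ∀ k, (A k k).im = 0 := fun k => (Complex.le_def.1 hA.diag_nonneg).2.symm
  have hle : ∀ k, (A k k).re ≤ A.trace.re := fun k => by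
    rw [Matrix.trace, Complex.re_sum]
    exact Finset.single_le_sum (f := fun k => (A k k).re) (fun k _ => hre k) (Finset.mem_univ k)
  have hdet := (Complex.le_def.1 (hA.submatrix ![i, j]).det_nonneg).1
  have hji : A j i = star (A i j) := (hA.1.apply j i).symm
  have h2 : A i j * A j i = ((‖A i j‖ ^ 2 : ℝ) : ℂ) := by
    rw [hji]; exact_mod_cast Complex.mul_conj' (A i j)
  simp only [Matrix.det_fin_two, Matrix.submatrix_apply, Matrix.cons_val_zero,
    Matrix.cons_val_one, h2] at hdet
  simp only [Complex.zero_re, Complex.sub_re, Complex.mul_re, him, Complex.ofReal_re] at hdet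
  nlinarith [hre i, hre j, hle i, hle j, norm_nonneg (A i j)]

/-- A compact convex set `C` of Hermitian matrices which, tested against every state, goes below
`N`, has a member below `N` in the Löwner order. -/
theorem exists_le_of_forall_state {C : Set (Matrix n n ℂ)} {N : Matrix n n ℂ}
    (hconv : Convex ℝ C) (hcomp : IsCompact C) (hherm : ∀ M ∈ C, M.IsHermitian)
    (hN : N.IsHermitian)
    (h : ∀ ρ : Matrix n n ℂ, ρ.PosSemidef → ρ.trace.re ≤ 1 → ∀ u : ℝ,
      (∀ M ∈ C, u ≤ (M * ρ).trace.re) → u ≤ (N * ρ).trace.re) :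
    ∃ M ∈ C, (N - M).PosSemidef := by
  classical
  by_contra! hcon
  have hclosed : IsClosed {A : Matrix n n ℂ | (N - A).PosSemidef} :=
    isClosed_posSemidef.preimage (f := fun A : Matrix n n ℂ => N - A) (by fun_prop)
  have htconv : Convex ℝ {A : Matrix n n ℂ | (N - A).PosSemidef} := by
    intro A hA B hB s t hs ht hst
    have h1 : N - (s • A + t • B) = s • (N - A) + t • (N - B) := by
      rw [smul_sub, smul_sub, sub_add_sub_comm, ← add_smul, hst, one_smul]
    rw [Set.mem_ofPred_eq, h1]
    exact (Matrix.PosSemidef.smul hA hs).add (Matrix.PosSemidef.smul hB ht)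
  have : LocallyConvexSpace ℝ (Matrix n n ℂ) :=
    inferInstanceAs (LocallyConvexSpace ℝ (n → n → ℂ))
  -- If no member of `C` lies below `N`, then `C` is disjoint from the closed convex set of matrices
  -- below `N`; `Re f` is less than `u` on `C` and greater than `v` on that set.
  obtain ⟨f, u, v, hu, huv, hv⟩ := RCLike.geometric_hahn_banach_compact_closed (𝕜 := ℂ)
    hconv hcomp htconv hclosed (Set.disjoint_left.2 fun A hA hA' => hcon A hA hA')
  set R : Matrix n n ℂ := Matrix.of fun i j => f (Matrix.single j i 1) with hR
  have hf : ∀ A, f A = (A * R).trace := by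
    intro A
    conv_lhs => rw [Matrix.matrix_eq_sum_single A]
    simp only [map_sum, Matrix.trace, Matrix.diag, Matrix.mul_apply]
    refine Finset.sum_congr rfl fun i _ => Finset.sum_congr rfl fun j _ => ?_
    have h1 : Matrix.single i j (A i j) = A i j • Matrix.single i j (1 : ℂ) := by simp
    rw [h1, map_smul]; simp [hR]
  -- Minus the Hermitian part of `R`: it represents `-Re f` on Hermitian matrices and will be the
  -- separating state up to scale.
  set S : Matrix n n ℂ := -((1 / 2 : ℝ) • (R + R.conjTranspose)) with hS
  have hfS : ∀ A : Matrix n n ℂ, A.IsHermitian → (A * S).trace.re = -(f A).re := by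
    intro A hA
    have h1 : (A * R.conjTranspose).trace = star (A * R).trace := by
      rw [← Matrix.trace_conjTranspose, Matrix.conjTranspose_mul, hA.eq, Matrix.trace_mul_comm]
    rw [hS, hf, Matrix.mul_neg, Matrix.trace_neg, Matrix.mul_smul, Matrix.trace_smul,
      Matrix.mul_add, Matrix.trace_add, h1]
    simp
    ring
  have hSherm : S.IsHermitian := by
    rw [hS, Matrix.IsHermitian, Matrix.conjTranspose_neg, Matrix.conjTranspose_smul,
      Matrix.conjTranspose_add, Matrix.conjTranspose_conjTranspose, add_comm]
    simp
  have hfpos : ∀ P : Matrix n n ℂ, P.PosSemidef → (f P).re ≤ 0 := by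
    intro P hP
    by_contra! hpos
    -- All `N - k P` lie below `N`, so `Re f` stays above `v` along this ray; a positive `Re f(P)`
    -- would contradict that for large `k`.
    obtain ⟨k, hk⟩ := exists_nat_gt (((f N).re - v) / (f P).re)
    have h1 := hv (N - (k : ℝ) • P) (by
      simpa using Matrix.PosSemidef.smul hP (Nat.cast_nonneg (α := ℝ) k))
    rw [map_sub, ← Complex.coe_smul, map_smul] at h1
    rw [div_lt_iff₀ hpos] at hk
    simp at h1
    linarith
  have hSpos : S.PosSemidef := by
    refine .of_dotProduct_mulVec_nonneg hSherm fun x => ?_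
    rw [← trace_vecMulVec_star_mul]
    have hx := Matrix.posSemidef_vecMulVec_self_star x
    refine Complex.le_def.2 ⟨?_, ?_⟩
    · rw [hfS _ hx.1]; simpa using hfpos _ hx
    · have h1 : star (Matrix.vecMulVec x (star x) * S).trace
          = (Matrix.vecMulVec x (star x) * S).trace := by
        rw [← Matrix.trace_conjTranspose, Matrix.conjTranspose_mul, hSherm.eq, hx.1.eq,
          Matrix.trace_mul_comm]
      exact (Complex.conj_eq_iff_im.1 h1).symm
  -- Scales `S` to trace at most 1; the `+ 1` covers trace zero. The bound `-(t * u)` then yields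
  -- `Re f(N) ≤ u < v < Re f(N)`.
  set t : ℝ := (S.trace.re + 1)⁻¹ with ht
  have htr : 0 ≤ S.trace.re := (Complex.le_def.1 hSpos.trace_nonneg).1
  have htpos : 0 < t := by positivity
  have hts : ∀ A : Matrix n n ℂ, A.IsHermitian → (A * (t • S)).trace.re = -(t * (f A).re) := by
    intro A hA
    rw [Matrix.mul_smul, Matrix.trace_smul, Complex.smul_re, hfS A hA]; simp
  have key := h (t • S) (hSpos.smul htpos.le) (by
      rw [Matrix.trace_smul, Complex.smul_re, smul_eq_mul, ht, inv_mul_le_iff₀ (by positivity)]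
      linarith) (-(t * u)) (fun M hM => by
      rw [hts M (hherm M hM)]
      have := hu M hM
      simp only [RCLike.re_to_complex] at this
      nlinarith)
  rw [hts N hN] at key
  have hvN := hv N (by simpa using Matrix.PosSemidef.zero)
  simp only [RCLike.re_to_complex] at hvN
  nlinarith

end MatrixPositivity

/-! ### Ampliations of super-operators -/

section IdTensor

variable {m n a c : Type*}

theorem IsCompletelyPositive.idTensor_posSemidef [Fintype a] {E : Matrix m m ℂ →ₗ[ℂ] Matrix n n ℂ}
    (hE : IsCompletelyPositive E) {M : Matrix (a × m) (a × m) ℂ} (hM : M.PosSemidef) :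
    (idTensor a E M).PosSemidef := by
  classical
  let e := Fintype.equivFin a
  have h1 := (hE _ _ (hM.submatrix (Prod.map e.symm id))).submatrix (Prod.map e id)
  convert h1 using 1
  ext p q
  simp [idTensor]

theorem trace_idTensor [Fintype a] [Fintype n] (E : Matrix m m ℂ →ₗ[ℂ] Matrix n n ℂ)
    (M : Matrix (a × m) (a × m) ℂ) :
    (idTensor a E M).trace = ∑ p, (E (M.submatrix (Prod.mk p) (Prod.mk p))).trace := by
  simp only [Matrix.trace, Fintype.sum_prod_type]
  rfl

theorem IsTraceNonincreasing.trace_idTensor_le [Fintype a] [Fintype m] [Fintype n]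
    {E : Matrix m m ℂ →ₗ[ℂ] Matrix n n ℂ} (hE : IsTraceNonincreasing E)
    {M : Matrix (a × m) (a × m) ℂ} (hM : M.PosSemidef) :
    (idTensor a E M).trace.re ≤ M.trace.re := by
  rw [trace_idTensor, Matrix.trace, Fintype.sum_prod_type, Complex.re_sum, Complex.re_sum]
  exact Finset.sum_le_sum fun p _ => hE _ (hM.submatrix (Prod.mk p))

theorem trace_idTensor_mul [Fintype a] [Fintype m] [Fintype n] [DecidableEq m]
    (E : Matrix m m ℂ →ₗ[ℂ] Matrix n n ℂ) (M : Matrix (a × m) (a × m) ℂ)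
    (N : Matrix (a × n) (a × n) ℂ) :
    (idTensor a E M * N).trace = (M * idTensor a (adjointSuper E) N).trace := by
  have hl : (idTensor a E M * N).trace
      = ∑ p, ∑ q, (E (M.submatrix (Prod.mk p) (Prod.mk q)) *
          N.submatrix (Prod.mk q) (Prod.mk p)).trace := by
    simp only [Matrix.trace, Matrix.diag, Matrix.mul_apply, Fintype.sum_prod_type]
    refine Finset.sum_congr rfl fun p _ => ?_
    rw [Finset.sum_comm]
    rfl
  have hr : (M * idTensor a (adjointSuper E) N).trace
      = ∑ p, ∑ q, (M.submatrix (Prod.mk p) (Prod.mk q) *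
          adjointSuper E (N.submatrix (Prod.mk q) (Prod.mk p))).trace := by
    simp only [Matrix.trace, Matrix.diag, Matrix.mul_apply, Fintype.sum_prod_type]
    refine Finset.sum_congr rfl fun p _ => ?_
    rw [Finset.sum_comm]
    rfl
  rw [hl, hr]
  simp only [trace_mul_adjointSuper]

/-- Conjugation by `K ⊗ 1` only forms linear combinations of blocks, and `E` acts linearly on each
block. Here `K` may be rectangular, so the ancilla can change. -/
theorem idTensor_conj_kronecker [Fintype a] [Fintype m] [Fintype n]
    [DecidableEq m] [DecidableEq n] (E : Matrix m m ℂ →ₗ[ℂ] Matrix n n ℂ)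
    (K : Matrix a c ℂ) (M : Matrix (a × m) (a × m) ℂ) :
    idTensor c E ((K ⊗ₖ (1 : Matrix m m ℂ)).conjTranspose * M * (K ⊗ₖ (1 : Matrix m m ℂ))) =
      (K ⊗ₖ (1 : Matrix n n ℂ)).conjTranspose * idTensor a E M * (K ⊗ₖ (1 : Matrix n n ℂ)) := by
  ext ⟨y, k⟩ ⟨z, l⟩
  have hblock : (Matrix.of fun i j => ((K ⊗ₖ (1 : Matrix m m ℂ)).conjTranspose * M *
      (K ⊗ₖ (1 : Matrix m m ℂ))) (y, i) (z, j)) =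
      ∑ q, ∑ p, (star (K p y) * K q z) • M.submatrix (Prod.mk p) (Prod.mk q) := by
    ext i j
    simp [Matrix.mul_apply, Fintype.sum_prod_type, Matrix.one_apply, Matrix.sum_apply,
      Finset.sum_mul]
    refine Finset.sum_congr rfl fun q _ => Finset.sum_congr rfl fun p _ => ?_
    simp only [apply_ite (starRingEnd ℂ), map_zero, ite_mul, zero_mul, Finset.sum_ite_eq',
      Finset.mem_univ, if_true]
    ring
  change E (Matrix.of fun i j => _) k l = _
  rw [hblock]
  simp only [map_sum, map_smul]
  simp [Matrix.mul_apply, Fintype.sum_prod_type, Matrix.one_apply, Matrix.sum_apply,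
    Finset.sum_mul]
  refine Finset.sum_congr rfl fun q _ => Finset.sum_congr rfl fun p _ => ?_
  simp only [apply_ite (starRingEnd ℂ), map_zero, ite_mul, zero_mul, Finset.sum_ite_eq',
    Finset.mem_univ, if_true]
  exact mul_right_comm _ _ _

theorem dotProduct_idTensor_mulVec_kronecker [Fintype a] [Fintype c] [Fintype m] [DecidableEq m]
    (E : Matrix m m ℂ →ₗ[ℂ] Matrix m m ℂ) (K : Matrix a c ℂ) (M : Matrix (a × m) (a × m) ℂ)
    (ω : c × m → ℂ) :
    star ((K ⊗ₖ (1 : Matrix m m ℂ)).mulVec ω) ⬝ᵥ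
        (idTensor a E M).mulVec ((K ⊗ₖ (1 : Matrix m m ℂ)).mulVec ω) =
      star ω ⬝ᵥ (idTensor c E ((K ⊗ₖ (1 : Matrix m m ℂ)).conjTranspose * M *
        (K ⊗ₖ (1 : Matrix m m ℂ)))).mulVec ω := by
  rw [idTensor_conj_kronecker, Matrix.star_mulVec, Matrix.mulVec_mulVec,
    ← Matrix.dotProduct_mulVec, Matrix.mulVec_mulVec, Matrix.mul_assoc]

end IdTensor

/-! ### Extension to larger systems and duality -/

section Extension

variable {𝒱 : Type*} [DecidableEq 𝒱] {V W X : Finset 𝒱}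

theorem extendSuper_apply (h : V ⊆ X) (E : SuperOp V) (M : Op X) :
    extendSuper h E M = (idTensor (Idx (X \ V)) E
      (M.submatrix (splitEquiv h).symm (splitEquiv h).symm)).submatrix
        (splitEquiv h) (splitEquiv h) := rfl

theorem trace_submatrix_equiv {m n : Type*} [Fintype m] [Fintype n] (e : m ≃ n)
    (A : Matrix n n ℂ) : (A.submatrix e e).trace = A.trace :=
  e.sum_comp fun i => A i i

theorem extendSuper_posSemidef (h : V ⊆ X) {E : SuperOp V} (hE : IsCompletelyPositive E)
    {M : Op X} (hM : M.PosSemidef) : (extendSuper h E M).PosSemidef :=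
  (hE.idTensor_posSemidef (hM.submatrix _)).submatrix _

theorem trace_extendSuper_le (h : V ⊆ X) {E : SuperOp V} (hE : IsTraceNonincreasing E)
    {M : Op X} (hM : M.PosSemidef) : (extendSuper h E M).trace.re ≤ M.trace.re := by
  rw [extendSuper_apply, trace_submatrix_equiv, ← trace_submatrix_equiv (splitEquiv h).symm M]
  exact hE.trace_idTensor_le (hM.submatrix _)

theorem adjointSuper_extendSuper (h : V ⊆ X) (E : SuperOp V) :
    adjointSuper (extendSuper h E) = extendSuper h (adjointSuper E) := by
  refine LinearMap.ext fun N => Matrix.ext_iff_trace_mul_left.2 fun M => ?_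
  rw [← trace_mul_adjointSuper, extendSuper_apply, extendSuper_apply,
    ← trace_submatrix_equiv (splitEquiv h).symm, ← trace_submatrix_equiv (splitEquiv h).symm
      (M * _), ← Matrix.submatrix_mul_equiv _ _ _ (splitEquiv h).symm,
    ← Matrix.submatrix_mul_equiv _ _ _ (splitEquiv h).symm]
  simpa using trace_idTensor_mul E _ _

/-- `G` touches only the coordinates in `V`, so the identity factor on `X \ W` is a scalar on each
block and linearity pulls it out. -/
theorem extendOp_extendSuper (hVW : V ⊆ W) (hWX : W ⊆ X) (hVX : V ⊆ X) (G : SuperOp V)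
    (N : Op W) : extendOp hWX (extendSuper hVW G N) = extendSuper hVX G (extendOp hWX N) := by
  have hfst : ∀ (x : Idx X) (i : Idx V),
      (splitEquiv hWX ((splitEquiv hVX).symm ((splitEquiv hVX x).1, i))).1
        = (splitEquiv hWX x).1 := by
    intro x i
    ext ⟨q, hq⟩
    have : q ∉ V := fun h => (Finset.mem_sdiff.1 hq).2 (hVW h)
    simp [splitEquiv, this]
  have hsnd : ∀ (x : Idx X) (i : Idx V),
      (splitEquiv hWX ((splitEquiv hVX).symm ((splitEquiv hVX x).1, i))).2
        = (splitEquiv hVW).symm ((splitEquiv hVW (splitEquiv hWX x).2).1, i) := by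
    intro x i
    ext ⟨q, hq⟩
    by_cases hqV : q ∈ V <;> simp [splitEquiv, hqV]
  ext x y
  have hblock : (Matrix.of fun i j => extendOp hWX N
      ((splitEquiv hVX).symm ((splitEquiv hVX x).1, i))
      ((splitEquiv hVX).symm ((splitEquiv hVX y).1, j))) =
      (1 : Op (X \ W)) (splitEquiv hWX x).1 (splitEquiv hWX y).1 •
      (Matrix.of fun i j => N
        ((splitEquiv hVW).symm ((splitEquiv hVW (splitEquiv hWX x).2).1, i))
        ((splitEquiv hVW).symm ((splitEquiv hVW (splitEquiv hWX y).2).1, j))) := by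
    ext i j
    exact congrArg₂ (· * ·) (congrArg₂ (1 : Op (X \ W)) (hfst x i) (hfst y j))
      (congrArg₂ N (hsnd x i) (hsnd y j))
  change _ = G (Matrix.of fun i j => extendOp hWX N
      ((splitEquiv hVX).symm ((splitEquiv hVX x).1, i))
      ((splitEquiv hVX).symm ((splitEquiv hVX y).1, j))) (splitEquiv hVX x).2 (splitEquiv hVX y).2
  rw [hblock, map_smul]
  rfl

theorem extendOp_sub (h : W ⊆ X) (M N : Op W) :
    extendOp h (M - N) = extendOp h M - extendOp h N := by
  ext x y; simp [extendOp, mul_sub]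

theorem extendOp_one (h : W ⊆ X) : extendOp h (1 : Op W) = 1 := by
  rw [extendOp, Matrix.one_kronecker_one, Matrix.submatrix_one_equiv]

theorem extendOp_self (h : W ⊆ W) (N : Op W) : extendOp h N = N := by
  have : IsEmpty {q // q ∈ W \ W} := ⟨fun q => by simpa using q.2⟩
  ext x y
  have h1 : (1 : Op (W \ W)) (splitEquiv h x).1 (splitEquiv h y).1 = 1 := by
    rw [Subsingleton.elim (splitEquiv h x).1 (splitEquiv h y).1, Matrix.one_apply_eq]
  change (1 : Op (W \ W)) (splitEquiv h x).1 (splitEquiv h y).1 * N x y = N x y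
  rw [h1, one_mul]

theorem extendOp_posSemidef (h : W ⊆ X) {N : Op W} (hN : N.PosSemidef) :
    (extendOp h N).PosSemidef :=
  (Matrix.PosSemidef.one.kronecker hN).submatrix _

theorem trace_extendOp_mul_extendSuper (hVW : V ⊆ W) (hWX : W ⊆ X) (hVX : V ⊆ X)
    (E : SuperOp V) (N : Op W) (ρ : Op X) :
    (extendOp hWX N * extendSuper hVX E ρ).trace =
      (extendOp hWX (adjointSuper (extendSuper hVW E) N) * ρ).trace := by
  rw [Matrix.trace_mul_comm, trace_mul_adjointSuper, Matrix.trace_mul_comm,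
    adjointSuper_extendSuper, adjointSuper_extendSuper, extendOp_extendSuper hVW hWX hVX]

/-- Both bounds are tested against positive `ρ`. The upper one uses `tr ρ - tr (E(ρ) N) = (tr ρ - tr
E(ρ)) + tr (E(ρ) (1 - N))`, a sum of nonnegative terms. -/
theorem adjointSuper_mem_effects (h : V ⊆ W) {E : SuperOp V} (hE : E ∈ DProg V) {N : Op W}
    (hN : N ∈ Effects W) : adjointSuper (extendSuper h E) N ∈ Effects W := by
  have hpos : (adjointSuper (extendSuper h E) N).PosSemidef :=
    posSemidef_of_trace_mul_nonneg fun ρ hρ => by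
      rw [← trace_mul_adjointSuper]
      exact trace_mul_nonneg (extendSuper_posSemidef h hE.1 hρ) hN.1
  refine ⟨hpos, posSemidef_of_trace_mul_nonneg fun ρ hρ => ?_⟩
  have h1 := Complex.le_def.1 (trace_mul_nonneg (extendSuper_posSemidef h hE.1 hρ) hN.2)
  have h2 := Complex.le_def.1 (extendSuper_posSemidef h hE.1 hρ).trace_nonneg
  have h3 := Complex.le_def.1 hρ.trace_nonneg
  have h4 := trace_extendSuper_le h hE.2 hρ
  rw [Matrix.mul_sub, Matrix.trace_sub, Matrix.mul_one] at h1 ⊢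
  rw [← trace_mul_adjointSuper]
  rw [Complex.le_def]
  simp only [Complex.zero_re, Complex.zero_im, Complex.sub_re, Complex.sub_im] at *
  exact ⟨by linarith [h1.1], by rw [← h3.2]; linarith [h1.2, h2.2]⟩

end Extension

/-! ### The maximally entangled state, Choi positivity, compactness -/

section MaximallyEntangled

variable {𝒱 : Type*} [DecidableEq 𝒱] {V V' W X : Finset 𝒱}

theorem matrix_of_orthonormal_mul_conjTranspose {ι n : Type*} [Fintype n] [DecidableEq ι]
    {v : ι → EuclideanSpace ℂ n} (hv : Orthonormal ℂ v) :
    (Matrix.of fun k i => v k i) * (Matrix.of fun k i => v k i).conjTranspose = 1 := by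
  ext k l
  rw [Matrix.one_apply, Matrix.mul_apply]
  have := orthonormal_iff_ite.1 hv l k
  simp only [EuclideanSpace.inner_eq_star_dotProduct, dotProduct] at this
  simp only [Matrix.conjTranspose_apply, Matrix.of_apply]
  simpa [eq_comm] using this

/-- Basis labels of the complement of `V` in `V ∪ V'`, for disjoint `V` and `V'`. -/
def idxUnionSdiffEquiv (hV : Disjoint V V') : Idx ((V ∪ V') \ V) ≃ Idx V' :=
  (Equiv.subtypeEquivRight fun q => by
    rw [Finset.union_sdiff_cancel_left hV]).arrowCongr (Equiv.refl _)

/-- The coefficients of `|ω⟩` as a matrix. -/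
noncomputable def omegaMatrix (b : OrthonormalBasis (Fin (2 ^ V.card)) ℂ (HSpace V))
    (b' : OrthonormalBasis (Fin (2 ^ V.card)) ℂ (HSpace V')) :
    Matrix (Idx ((V ∪ V') \ V)) (Idx V) ℂ :=
  Matrix.of fun y i =>
    omegaVec b b' ((splitEquiv (Finset.subset_union_left (s₂ := V'))).symm (y, i))

variable (b : OrthonormalBasis (Fin (2 ^ V.card)) ℂ (HSpace V))
  (b' : OrthonormalBasis (Fin (2 ^ V.card)) ℂ (HSpace V'))

/-- The coefficients of `|ω⟩` factor through the two basis matrices, which makes them a scaled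
unitary up to relabelling. -/
theorem omegaMatrix_eq (hV : Disjoint V V') :
    omegaMatrix b b' = ((1 / Real.sqrt (2 ^ V.card) : ℝ) : ℂ) •
      (((Matrix.of fun k i => b' k i).submatrix id (idxUnionSdiffEquiv hV)).transpose *
        Matrix.of fun k i => b k i) := by
  ext y i
  simp only [omegaMatrix, omegaVec, Matrix.of_apply, Matrix.smul_apply, Matrix.mul_apply,
    Matrix.transpose_apply, Matrix.submatrix_apply, smul_eq_mul]
  congr 1
  refine Finset.sum_congr rfl fun k _ => ?_
  rw [mul_comm]
  refine congrArg₂ (· * ·) (congrArg (fun x => b' k x) (funext fun q => ?_))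
    (congrArg (fun x => b k x) (funext fun q => ?_))
  · have : q.1 ∉ V := Finset.disjoint_right.1 hV q.2
    simp [splitEquiv, idxUnionSdiffEquiv, this]
    rfl
  · simp [splitEquiv]

theorem basisMatrix_submatrix_mul_conjTranspose (hV : Disjoint V V') :
    (Matrix.of fun k i => b' k i).submatrix id (idxUnionSdiffEquiv hV) *
      ((Matrix.of fun k i => b' k i).submatrix id (idxUnionSdiffEquiv hV)).conjTranspose = 1 := by
  rw [Matrix.conjTranspose_submatrix, Matrix.submatrix_mul_equiv,
    matrix_of_orthonormal_mul_conjTranspose b'.orthonormal, Matrix.submatrix_id_id]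

theorem exists_mul_omegaMatrix_eq_one (hV : Disjoint V V') :
    ∃ L : Matrix (Idx V) (Idx ((V ∪ V') \ V)) ℂ, L * omegaMatrix b b' = 1 := by
  set B : Matrix (Fin (2 ^ V.card)) (Idx V) ℂ := Matrix.of fun k i => b k i with hB
  set B' : Matrix (Fin (2 ^ V.card)) (Idx ((V ∪ V') \ V)) ℂ :=
    (Matrix.of fun k i => b' k i).submatrix id (idxUnionSdiffEquiv hV) with hB'
  set s : ℂ := ((1 / Real.sqrt (2 ^ V.card) : ℝ) : ℂ) with hs
  have hs0 : s ≠ 0 := Complex.ofReal_ne_zero.2 (by positivity)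
  have h1 : B * B.conjTranspose = 1 := matrix_of_orthonormal_mul_conjTranspose b.orthonormal
  -- `B` is square, so its one-sided inverse is two-sided.
  have h2 : B.conjTranspose * B = 1 :=
    (Matrix.mul_eq_one_comm_of_card_eq _ _ _ (by simp [Fintype.card_pi])).1 h1
  have h3 : B'.conjTranspose.transpose * B'.transpose = 1 := by
    rw [← Matrix.transpose_mul, hB', basisMatrix_submatrix_mul_conjTranspose,
      Matrix.transpose_one]
  refine ⟨s⁻¹ • (B.conjTranspose * B'.conjTranspose.transpose), ?_⟩
  rw [omegaMatrix_eq b b' hV, Matrix.smul_mul, Matrix.mul_smul, smul_smul, inv_mul_cancel₀ hs0,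
    one_smul, Matrix.mul_assoc, ← Matrix.mul_assoc _ B'.transpose, h3, Matrix.one_mul, h2]

theorem star_omegaVec_dotProduct_omegaVec (hV : Disjoint V V') :
    star (omegaVec b b') ⬝ᵥ omegaVec b b' = 1 := by
  set B : Matrix (Fin (2 ^ V.card)) (Idx V) ℂ := Matrix.of fun k i => b k i with hB
  set B' : Matrix (Fin (2 ^ V.card)) (Idx ((V ∪ V') \ V)) ℂ :=
    (Matrix.of fun k i => b' k i).submatrix id (idxUnionSdiffEquiv hV) with hB'
  set s : ℝ := 1 / Real.sqrt (2 ^ V.card) with hs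
  have h1 : B * B.conjTranspose = 1 := matrix_of_orthonormal_mul_conjTranspose b.orthonormal
  have h3 : B'.transpose.conjTranspose * B'.transpose = 1 := by
    change B'.conjTranspose.transpose * B'.transpose = 1
    rw [← Matrix.transpose_mul, hB',
      basisMatrix_submatrix_mul_conjTranspose, Matrix.transpose_one]
  -- The squared norm of a bipartite vector is the squared Hilbert–Schmidt norm of its coefficient
  -- matrix.
  have htr : star (omegaVec b b') ⬝ᵥ omegaVec b b' =
      ((omegaMatrix b b').conjTranspose * omegaMatrix b b').trace := by
    rw [dotProduct, ← (splitEquiv (Finset.subset_union_left (s₂ := V'))).symm.sum_comp,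
      Fintype.sum_prod_type, Finset.sum_comm]
    rfl
  rw [htr, omegaMatrix_eq b b' hV, Matrix.conjTranspose_smul, Matrix.smul_mul, Matrix.mul_smul,
    smul_smul, Matrix.conjTranspose_mul, Matrix.mul_assoc, ← Matrix.mul_assoc _ B'.transpose, h3,
    Matrix.one_mul, Matrix.trace_smul, Matrix.trace_mul_comm, h1, Matrix.trace_one]
  have hsd : s * s * 2 ^ V.card = 1 := by
    rw [hs, div_mul_div_comm, Real.mul_self_sqrt (by positivity)]; field_simp
  simp only [Complex.star_def, Complex.conj_ofReal, Fintype.card_fin, smul_eq_mul, ← hs]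
  clear_value s
  exact_mod_cast hsd

theorem one_sub_vecMulVec_posSemidef {n : Type*} [Fintype n] [DecidableEq n] {v : n → ℂ}
    (hv : star v ⬝ᵥ v = 1) : (1 - Matrix.vecMulVec v (star v)).PosSemidef := by
  have hherm := (Matrix.posSemidef_vecMulVec_self_star v).1
  have hidem : Matrix.vecMulVec v (star v) * Matrix.vecMulVec v (star v) =
      Matrix.vecMulVec v (star v) := by
    rw [Matrix.vecMulVec_mul_vecMulVec, hv, one_smul]
  have h : 1 - Matrix.vecMulVec v (star v) =
      (1 - Matrix.vecMulVec v (star v)).conjTranspose * (1 - Matrix.vecMulVec v (star v)) := by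
    rw [Matrix.conjTranspose_sub, Matrix.conjTranspose_one, hherm.eq, Matrix.sub_mul,
      Matrix.mul_sub, Matrix.mul_sub, hidem]
    simp
  rw [h]
  exact Matrix.posSemidef_conjTranspose_mul_self _

theorem Omega_mem_effects (hV : Disjoint V V') : Omega b b' ∈ Effects (V ∪ V') :=
  ⟨Matrix.posSemidef_vecMulVec_self_star _,
    one_sub_vecMulVec_posSemidef (star_omegaVec_dotProduct_omegaVec b b' hV)⟩

/-- A super-operator whose adjoint maps the maximally entangled state to a positive operator is
completely positive. -/
theorem extendSuper_posSemidef_of_adjointSuper_Omega (hV : Disjoint V V') {G : SuperOp V}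
    (hG : (adjointSuper (extendSuper (Finset.subset_union_left (s₂ := V')) G)
      (Omega b b')).PosSemidef) (hX : V ⊆ X) {ρ : Op X} (hρ : ρ.PosSemidef) :
    (extendSuper hX G ρ).PosSemidef := by
  obtain ⟨L, hL⟩ := exists_mul_omegaMatrix_eq_one b b' hV
  refine Matrix.PosSemidef.submatrix (posSemidef_of_dotProduct_nonneg fun φ => ?_) (splitEquiv hX)
  set s := splitEquiv (Finset.subset_union_left (s₁ := V) (s₂ := V')) with hs
  set M := ρ.submatrix (splitEquiv hX).symm (splitEquiv hX).symm with hM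
  -- Undoes the coefficient matrix of `|ω⟩` and installs that of `φ`, so that `(K ⊗ 1)|ω⟩ = φ`.
  let K : Matrix (Idx (X \ V)) (Idx ((V ∪ V') \ V)) ℂ := (Matrix.of fun p i => φ (p, i)) * L
  have hφ : (K ⊗ₖ (1 : Op V)).mulVec (omegaVec b b' ∘ s.symm) = φ := by
    ext ⟨p, i⟩
    have h1 : K * omegaMatrix b b' = Matrix.of fun p i => φ (p, i) := by
      rw [Matrix.mul_assoc, hL, Matrix.mul_one]
    have h2 := congrFun (congrFun h1 p) i
    rw [Matrix.of_apply] at h2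
    rw [← h2, Matrix.mul_apply, Matrix.mulVec, dotProduct, Fintype.sum_prod_type]
    refine Finset.sum_congr rfl fun y _ => ?_
    rw [Finset.sum_eq_single i]
    · simp [omegaMatrix, hs]
    · intro j _ hj; simp [Matrix.one_apply_ne hj.symm]
    · simp
  set M' := (K ⊗ₖ (1 : Op V)).conjTranspose * M * (K ⊗ₖ (1 : Op V)) with hM'
  have hM'pos : M'.PosSemidef := (hρ.submatrix _).conjTranspose_mul_mul_same _
  change 0 ≤ star φ ⬝ᵥ (idTensor (Idx (X \ V)) G M).mulVec φ
  rw [← hφ, dotProduct_idTensor_mulVec_kronecker, ← trace_vecMulVec_star_mul,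
    ← trace_submatrix_equiv s, ← Matrix.submatrix_mul_equiv _ _ _ s, Matrix.trace_mul_comm]
  have h1 : (Matrix.vecMulVec (omegaVec b b' ∘ s.symm) (star (omegaVec b b' ∘ s.symm))).submatrix
      s s = Omega b b' := by
    ext x y; simp [Omega, Matrix.vecMulVec_apply]
  have h2 : (idTensor (Idx ((V ∪ V') \ V)) G M').submatrix s s =
      extendSuper Finset.subset_union_left G (M'.submatrix s s) := by
    rw [extendSuper_apply, Matrix.submatrix_submatrix]; simp [hs]
  rw [h1, h2, trace_mul_adjointSuper]
  exact trace_mul_nonneg (hM'pos.submatrix _) hG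

/-- `𝓔 ↦ 𝓔†(N)` as a linear map. -/
noncomputable def adjointApply (h : V ⊆ W) (N : Op W) : SuperOp V →ₗ[ℂ] Op W where
  toFun E := adjointSuper (extendSuper h E) N
  map_add' E F := by
    ext i j
    change ((extendSuper h E (Matrix.single j i 1) + extendSuper h F (Matrix.single j i 1)) *
      N).trace = _
    rw [Matrix.add_mul, Matrix.trace_add]; rfl
  map_smul' r E := by
    ext i j
    change ((r • extendSuper h E (Matrix.single j i 1)) * N).trace = _
    rw [Matrix.smul_mul, Matrix.trace_smul]; rfl

theorem adjointApply_apply (h : V ⊆ W) (N : Op W) (E : SuperOp V) :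
    adjointApply h N E = adjointSuper (extendSuper h E) N := rfl

/-- These are the entries of the Choi matrix, which is positive with trace at most that of the
unnormalised maximally entangled projector; that trace does not depend on `E`. -/
theorem exists_norm_apply_single_le (V : Finset 𝒱) :
    ∃ R : ℝ, ∀ E ∈ DProg V, ∀ i j k l, ‖E (Matrix.single i j 1) k l‖ ≤ R := by
  let v : Idx V × Idx V → ℂ := fun p => if p.1 = p.2 then 1 else 0
  have hv := Matrix.posSemidef_vecMulVec_self_star v
  refine ⟨(Matrix.vecMulVec v (star v)).trace.re, fun E hE i j k l => ?_⟩
  have h1 : E (Matrix.single i j 1) k l =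
      idTensor (Idx V) E (Matrix.vecMulVec v (star v)) (i, k) (j, l) := by
    change _ = E (Matrix.of fun i' j' => Matrix.vecMulVec v (star v) (i, i') (j, j')) k l
    refine congrArg (fun A => E A k l) (Matrix.ext fun i' j' => ?_)
    simp only [Matrix.single_apply, Matrix.of_apply, Matrix.vecMulVec_apply, v, Pi.star_apply]
    by_cases h1 : i = i' <;> by_cases h2 : j = j' <;> simp [h1, h2]
  rw [h1]
  exact (norm_apply_le_trace (hE.1.idTensor_posSemidef hv) _ _).trans (hE.2.trace_idTensor_le hv)

theorem IsNProg.isCompact_toMatrix {𝔼 : Set (SuperOp V)} (h𝔼 : IsNProg V 𝔼) :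
    IsCompact (LinearMap.toMatrix (Matrix.stdBasis ℂ (Idx V) (Idx V))
      (Matrix.stdBasis ℂ (Idx V) (Idx V)) '' 𝔼) := by
  obtain ⟨R, hR⟩ := exists_norm_apply_single_le V
  have hK : IsCompact (Set.univ.pi fun _ : Idx V × Idx V => Set.univ.pi fun _ : Idx V × Idx V =>
      Metric.closedBall (0 : ℂ) R) :=
    isCompact_univ_pi fun _ => isCompact_univ_pi fun _ => isCompact_closedBall _ _
  refine IsCompact.of_isClosed_subset hK h𝔼.closed ?_
  rintro _ ⟨E, hE, rfl⟩ p - q -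
  rw [mem_closedBall_zero_iff]
  have h1 := hR E (h𝔼.subset hE) q.1 q.2 p.1 p.2
  rwa [LinearMap.toMatrix_apply, Matrix.stdBasis_eq_single]

theorem IsNProg.isCompact_adjointApply {𝔼 : Set (SuperOp V)} (h𝔼 : IsNProg V 𝔼) (h : V ⊆ W)
    (N : Op W) : IsCompact (adjointApply h N '' 𝔼) := by
  let e := LinearMap.toMatrix (Matrix.stdBasis ℂ (Idx V) (Idx V))
    (Matrix.stdBasis ℂ (Idx V) (Idx V))
  -- Compactness is known for the matrix representations, so the map is factored through them.
  have h1 : adjointApply h N '' 𝔼 = (adjointApply h N ∘ₗ e.symm.toLinearMap) '' (e '' 𝔼) := by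
    rw [Set.image_image]; simp
  rw [h1]
  exact h𝔼.isCompact_toMatrix.image (LinearMap.continuous_of_finiteDimensional _)

theorem IsNProg.convex_adjointApply {𝔼 : Set (SuperOp V)} (h𝔼 : IsNProg V 𝔼) (h : V ⊆ W)
    (N : Op W) : Convex ℝ (adjointApply h N '' 𝔼) :=
  h𝔼.convex.linear_image ((adjointApply h N).restrictScalars ℝ)

end MaximallyEntangled

/-! ### Demonic expectation, correctness and weakest preconditions -/

section Satisfaction

variable {𝒱 : Type*} [DecidableEq 𝒱] {V V' W X : Finset 𝒱}

theorem trace_re_nonneg {n : Type*} [Fintype n] {A : Matrix n n ℂ} (hA : A.PosSemidef) :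
    0 ≤ A.trace.re := (Complex.le_def.1 hA.trace_nonneg).1

theorem trace_mul_re_nonneg {n : Type*} [Fintype n] {A B : Matrix n n ℂ} (hA : A.PosSemidef)
    (hB : B.PosSemidef) : 0 ≤ (A * B).trace.re := (Complex.le_def.1 (trace_mul_nonneg hA hB)).1

theorem one_sub_extendOp_posSemidef (h : W ⊆ X) {M : Op W} (hM : M ∈ Effects W) :
    (1 - extendOp h M).PosSemidef := by
  rw [← extendOp_one h, ← extendOp_sub]
  exact extendOp_posSemidef h hM.2

theorem le_expDem (h : W ⊆ X) {σ : Op X} {Θ : Set (Op W)} (hne : Θ.Nonempty) {u : ℝ}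
    (hu : ∀ M ∈ Θ, u ≤ (extendOp h M * σ).trace.re) : u ≤ expDem h σ Θ := by
  rw [expDem, if_neg hne.ne_empty]
  exact le_csInf (hne.image _) (by rintro _ ⟨M, hM, rfl⟩; exact hu M hM)

theorem expDem_le (h : W ⊆ X) {σ : Op X} (hσ : σ.PosSemidef) {Θ : Set (Op W)}
    (hΘ : Θ ⊆ Effects W) {M : Op W} (hM : M ∈ Θ) :
    expDem h σ Θ ≤ (extendOp h M * σ).trace.re := by
  rw [expDem, if_neg (Set.nonempty_of_mem hM).ne_empty]
  refine csInf_le ⟨0, ?_⟩ ⟨M, hM, rfl⟩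
  rintro _ ⟨N, hN, rfl⟩
  exact trace_mul_re_nonneg (extendOp_posSemidef h (hΘ hN).1) hσ

theorem expDem_singleton (h : W ⊆ X) (σ : Op X) (M : Op W) :
    expDem h σ {M} = (extendOp h M * σ).trace.re := by
  simp [expDem]

theorem expDem_empty (h : W ⊆ X) (σ : Op X) : expDem h σ ∅ = σ.trace.re := by
  simp [expDem]

theorem expDem_nonneg (h : W ⊆ X) {σ : Op X} (hσ : σ.PosSemidef) {Θ : Set (Op W)}
    (hΘ : Θ ⊆ Effects W) : 0 ≤ expDem h σ Θ := by
  rcases Θ.eq_empty_or_nonempty with rfl | hne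
  · rw [expDem_empty]; exact trace_re_nonneg hσ
  · exact le_expDem h hne fun M hM => trace_mul_re_nonneg (extendOp_posSemidef h (hΘ hM).1) hσ

theorem expDem_mono (h : W ⊆ X) {σ τ : Op X} (hσ : σ.PosSemidef) (hστ : (τ - σ).PosSemidef)
    {Θ : Set (Op W)} (hΘ : Θ ⊆ Effects W) : expDem h σ Θ ≤ expDem h τ Θ := by
  rcases Θ.eq_empty_or_nonempty with rfl | hne
  · have := trace_re_nonneg hστ
    rw [Matrix.trace_sub, Complex.sub_re] at this
    rw [expDem_empty, expDem_empty]; linarith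
  · refine le_expDem h hne fun M hM => (expDem_le h hσ hΘ hM).trans ?_
    have := trace_mul_re_nonneg (extendOp_posSemidef h (hΘ hM).1) hστ
    rw [Matrix.mul_sub, Matrix.trace_sub, Complex.sub_re] at this
    linarith

/-- For nonempty `Θ` the difference is minus the supremum of `tr ((1 - M) τ)`, and each `1 - M` is
positive; for empty `Θ` it is zero. -/
theorem expDem_sub_trace_antitone (h : W ⊆ X) {σ τ : Op X} (hτ : τ.PosSemidef)
    (hστ : (τ - σ).PosSemidef) {Θ : Set (Op W)} (hΘ : Θ ⊆ Effects W) :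
    expDem h τ Θ - τ.trace.re ≤ expDem h σ Θ - σ.trace.re := by
  rcases Θ.eq_empty_or_nonempty with rfl | hne
  · simp [expDem_empty]
  · have : expDem h τ Θ - τ.trace.re + σ.trace.re ≤ expDem h σ Θ := by
      refine le_expDem h hne fun M hM => ?_
      have h1 := expDem_le h hτ hΘ hM
      have h2 := trace_mul_re_nonneg (one_sub_extendOp_posSemidef h (hΘ hM)) hστ
      rw [Matrix.mul_sub, Matrix.sub_mul, Matrix.sub_mul, Matrix.one_mul, Matrix.one_mul,
        Matrix.trace_sub, Matrix.trace_sub, Matrix.trace_sub] at h2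
      simp only [Complex.sub_re] at h2
      linarith
    linarith

/-- The real `sInf` is a true infimum here: the set is nonempty and bounded below by 0, so its
default value never enters. -/
theorem satTot_iff {𝔼 : Set (SuperOp V)} (h𝔼 : IsNProg V 𝔼) {S : Set (Op W) × Set (Op W)}
    (hS : S.2 ⊆ Effects W) :
    SatTot 𝔼 S ↔ ∀ (X : Finset 𝒱) (hV : V ⊆ X) (hW : W ⊆ X), ∀ ρ ∈ States X, ∀ E ∈ 𝔼,
      expDem hW ρ S.1 ≤ expDem hW (extendSuper hV E ρ) S.2 := by
  refine forall_congr' fun X => forall_congr' fun hV => forall_congr' fun hW =>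
    forall_congr' fun ρ => forall_congr' fun hρ => ?_
  rw [outputs, Set.image_image, le_csInf_iff _ (h𝔼.nonempty.image _), Set.forall_mem_image]
  refine ⟨0, ?_⟩
  rintro _ ⟨E, hE, rfl⟩
  exact expDem_nonneg hW (extendSuper_posSemidef hV (h𝔼.subset hE).1 hρ.1) hS

theorem satPar_iff {𝔼 : Set (SuperOp V)} (h𝔼 : IsNProg V 𝔼) {S : Set (Op W) × Set (Op W)}
    (hS : S.2 ⊆ Effects W) :
    SatPar 𝔼 S ↔ ∀ (X : Finset 𝒱) (hV : V ⊆ X) (hW : W ⊆ X), ∀ ρ ∈ States X, ∀ E ∈ 𝔼,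
      expDem hW ρ S.1 ≤ expDem hW (extendSuper hV E ρ) S.2 + ρ.trace.re -
        (extendSuper hV E ρ).trace.re := by
  refine forall_congr' fun X => forall_congr' fun hV => forall_congr' fun hW =>
    forall_congr' fun ρ => forall_congr' fun hρ => ?_
  rw [outputs, Set.image_image, le_csInf_iff _ (h𝔼.nonempty.image _), Set.forall_mem_image]
  refine ⟨0, ?_⟩
  rintro _ ⟨E, hE, rfl⟩
  have h1 := expDem_nonneg hW (extendSuper_posSemidef hV (h𝔼.subset hE).1 hρ.1) hS
  have h2 := trace_extendSuper_le hV (h𝔼.subset hE).2 hρ.1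
  simp only
  linarith

theorem refinesTot_of_forall_exists_le {𝔼 𝔽 : Set (SuperOp V)} (h𝔼 : IsNProg V 𝔼)
    (h𝔽 : IsNProg V 𝔽)
    (h : ∀ F ∈ 𝔽, ∃ E ∈ 𝔼, ∀ (X : Finset 𝒱) (hV : V ⊆ X) (ρ : Op X), ρ.PosSemidef →
      (extendSuper hV (F - E) ρ).PosSemidef) : RefinesTot 𝔼 𝔽 := by
  intro W S hS hsat
  rw [satTot_iff h𝔽 hS.2]
  rw [satTot_iff h𝔼 hS.2] at hsat
  intro X hV hW ρ hρ F hF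
  obtain ⟨E, hE, hEF⟩ := h F hF
  exact (hsat X hV hW ρ hρ E hE).trans
    (expDem_mono hW (extendSuper_posSemidef hV (h𝔼.subset hE).1 hρ.1) (hEF X hV ρ hρ.1) hS.2)

theorem refinesPar_of_forall_exists_ge {𝔼 𝔽 : Set (SuperOp V)} (h𝔼 : IsNProg V 𝔼)
    (h𝔽 : IsNProg V 𝔽)
    (h : ∀ F ∈ 𝔽, ∃ E ∈ 𝔼, ∀ (X : Finset 𝒱) (hV : V ⊆ X) (ρ : Op X), ρ.PosSemidef →
      (extendSuper hV (E - F) ρ).PosSemidef) : RefinesPar 𝔼 𝔽 := by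
  intro W S hS hsat
  rw [satPar_iff h𝔽 hS.2]
  rw [satPar_iff h𝔼 hS.2] at hsat
  intro X hV hW ρ hρ F hF
  obtain ⟨E, hE, hEF⟩ := h F hF
  have h1 := hsat X hV hW ρ hρ E hE
  have h2 := expDem_sub_trace_antitone hW (σ := extendSuper hV F ρ)
    (extendSuper_posSemidef hV (h𝔼.subset hE).1 hρ.1) (hEF X hV ρ hρ.1) hS.2
  linarith

theorem wp_singleton (h : V ⊆ W) (𝔼 : Set (SuperOp V)) (N : Op W) :
    wp h 𝔼 {N} = adjointApply h N '' 𝔼 := by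
  rw [wp, adjointSet, Set.image2_singleton_right]; rfl

theorem wlp_singleton_one_sub (h : V ⊆ W) (𝔼 : Set (SuperOp V)) (N : Op W) :
    wlp h 𝔼 {1 - N} = (fun A => 1 - A) '' (adjointApply h N '' 𝔼) := by
  rw [wlp, oneMinus, oneMinus, Set.image_singleton, sub_sub_cancel]
  exact congrArg _ (wp_singleton h 𝔼 N)

theorem one_sub_mem_effects {𝒱 : Type*} {W : Finset 𝒱} {N : Op W} (hN : N ∈ Effects W) : 1 - N ∈ Effects W :=
  ⟨hN.2, by simpa using hN.1⟩

theorem wp_subset_effects (h : V ⊆ W) {𝔼 : Set (SuperOp V)} (h𝔼 : IsNProg V 𝔼) {N : Op W}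
    (hN : N ∈ Effects W) : wp h 𝔼 {N} ⊆ Effects W := by
  rw [wp_singleton]
  rintro _ ⟨E, hE, rfl⟩
  exact adjointSuper_mem_effects h (h𝔼.subset hE) hN

theorem wlp_subset_effects (h : V ⊆ W) {𝔼 : Set (SuperOp V)} (h𝔼 : IsNProg V 𝔼) {N : Op W}
    (hN : N ∈ Effects W) : wlp h 𝔼 {1 - N} ⊆ Effects W := by
  rw [wlp_singleton_one_sub]
  rintro _ ⟨_, ⟨E, hE, rfl⟩, rfl⟩
  exact one_sub_mem_effects (adjointSuper_mem_effects h (h𝔼.subset hE) hN)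

/-- By duality `E†(N)` gives on `ρ` exactly the expectation of `N` on `E(ρ)`, and it is one of the
effects in the infimum. -/
theorem satTot_wp (h : V ⊆ W) {𝔼 : Set (SuperOp V)} (h𝔼 : IsNProg V 𝔼) {N : Op W}
    (hN : N ∈ Effects W) : SatTot 𝔼 (wp h 𝔼 {N}, {N}) := by
  rw [satTot_iff h𝔼 (Set.singleton_subset_iff.2 hN)]
  intro X hV hW ρ hρ E hE
  rw [expDem_singleton, trace_extendOp_mul_extendSuper h hW hV]
  refine expDem_le hW hρ.1 (wp_subset_effects h h𝔼 hN) ?_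
  rw [wp_singleton]
  exact ⟨E, hE, rfl⟩

theorem satPar_wlp (h : V ⊆ W) {𝔼 : Set (SuperOp V)} (h𝔼 : IsNProg V 𝔼) {N : Op W}
    (hN : N ∈ Effects W) : SatPar 𝔼 (wlp h 𝔼 {1 - N}, {1 - N}) := by
  rw [satPar_iff h𝔼 (Set.singleton_subset_iff.2 (one_sub_mem_effects hN))]
  intro X hV hW ρ hρ E hE
  have h1 : expDem hW ρ (wlp h 𝔼 {1 - N}) ≤ _ :=
    expDem_le hW hρ.1 (wlp_subset_effects h h𝔼 hN) (M := 1 - adjointApply h N E) (by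
      rw [wlp_singleton_one_sub]
      exact ⟨_, ⟨E, hE, rfl⟩, rfl⟩)
  refine h1.trans (le_of_eq ?_)
  rw [expDem_singleton, extendOp_sub, extendOp_sub, extendOp_one, Matrix.sub_mul, Matrix.sub_mul,
    Matrix.one_mul, Matrix.one_mul, Matrix.trace_sub, Matrix.trace_sub,
    trace_extendOp_mul_extendSuper h hW hV, adjointApply_apply]
  simp only [Complex.sub_re]
  ring

/-- Satisfaction on `X = W` alone supplies the statewise inequality; separation makes the choice of
`E` uniform in the state. -/
theorem exists_adjointSuper_le_of_satTot (h : V ⊆ W) {𝔼 𝔽 : Set (SuperOp V)}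
    (h𝔼 : IsNProg V 𝔼) (h𝔽 : IsNProg V 𝔽) {N : Op W} (hN : N ∈ Effects W)
    (hsat : SatTot 𝔽 (wp h 𝔼 {N}, {N})) {F : SuperOp V} (hF : F ∈ 𝔽) :
    ∃ E ∈ 𝔼, (adjointSuper (extendSuper h (F - E)) N).PosSemidef := by
  rw [satTot_iff h𝔽 (Set.singleton_subset_iff.2 hN)] at hsat
  have key := exists_le_of_forall_state (h𝔼.convex_adjointApply h N) (h𝔼.isCompact_adjointApply h N)
    (N := adjointApply h N F)
    (by rintro _ ⟨E, hE, rfl⟩; exact (adjointSuper_mem_effects h (h𝔼.subset hE) hN).1.1)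
    (adjointSuper_mem_effects h (h𝔽.subset hF) hN).1.1
    (fun ρ hρ htr u hu => by
      have h1 := hsat W h subset_rfl ρ ⟨hρ, htr⟩ F hF
      rw [expDem_singleton, trace_extendOp_mul_extendSuper h subset_rfl h, extendOp_self] at h1
      refine (le_expDem subset_rfl ?_ ?_).trans h1
      · rw [wp_singleton]; exact h𝔼.nonempty.image _
      · intro M hM
        rw [wp_singleton] at hM
        rw [extendOp_self]
        exact hu M hM)
  obtain ⟨_, ⟨E, hE, rfl⟩, hEF⟩ := key
  refine ⟨E, hE, ?_⟩
  rwa [← map_sub, adjointApply_apply] at hEF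

theorem exists_adjointSuper_ge_of_satPar (h : V ⊆ W) {𝔼 𝔽 : Set (SuperOp V)}
    (h𝔼 : IsNProg V 𝔼) (h𝔽 : IsNProg V 𝔽) {N : Op W} (hN : N ∈ Effects W)
    (hsat : SatPar 𝔽 (wlp h 𝔼 {1 - N}, {1 - N})) {F : SuperOp V} (hF : F ∈ 𝔽) :
    ∃ E ∈ 𝔼, (adjointSuper (extendSuper h (E - F)) N).PosSemidef := by
  rw [satPar_iff h𝔽 (Set.singleton_subset_iff.2 (one_sub_mem_effects hN))] at hsat
  -- Complementation is negation followed by translation by 1.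
  have hconv : Convex ℝ ((fun A : Op W => 1 - A) '' (adjointApply h N '' 𝔼)) := by
    have := ((h𝔼.convex_adjointApply h N).neg).translate (1 : Op W)
    rw [← Set.image_neg_eq_neg, Set.image_image] at this
    simpa only [← sub_eq_add_neg] using this
  have key := exists_le_of_forall_state hconv
    ((h𝔼.isCompact_adjointApply h N).image (by fun_prop))
    (N := 1 - adjointApply h N F)
    (by
      rintro _ ⟨_, ⟨E, hE, rfl⟩, rfl⟩
      exact (adjointSuper_mem_effects h (h𝔼.subset hE) hN).2.1)
    (adjointSuper_mem_effects h (h𝔽.subset hF) hN).2.1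
    (fun ρ hρ htr u hu => by
      have h1 := hsat W h subset_rfl ρ ⟨hρ, htr⟩ F hF
      rw [expDem_singleton, extendOp_sub, extendOp_one, Matrix.sub_mul, Matrix.one_mul,
        Matrix.trace_sub, trace_extendOp_mul_extendSuper h subset_rfl h, extendOp_self] at h1
      have h2 : u ≤ expDem subset_rfl ρ (wlp h 𝔼 {1 - N}) := by
        refine le_expDem subset_rfl ?_ ?_
        · rw [wlp_singleton_one_sub]; exact (h𝔼.nonempty.image _).image _
        · intro M hM
          rw [wlp_singleton_one_sub] at hM
          rw [extendOp_self]
          exact hu M hM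
      rw [Matrix.sub_mul, Matrix.one_mul, Matrix.trace_sub, adjointApply_apply]
      simp only [Complex.sub_re] at h1 ⊢
      linarith)
  obtain ⟨_, ⟨_, ⟨E, hE, rfl⟩, rfl⟩, hEF⟩ := key
  refine ⟨E, hE, ?_⟩
  rwa [sub_sub_sub_cancel_left, ← map_sub, adjointApply_apply] at hEF

end Satisfaction

end QRefine

/-! ### The two characterisations of refinement -/

theorem mainTheorem10 {𝒱 : Type*} [DecidableEq 𝒱] [Countable 𝒱] [Infinite 𝒱]
    (V V' : Finset 𝒱) (hV' : IsDisjointCopy V' V)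
    (b : OrthonormalBasis (Fin (2 ^ V.card)) ℂ (HSpace V))
    (b' : OrthonormalBasis (Fin (2 ^ V.card)) ℂ (HSpace V'))
    (𝔼 𝔽 : Set (SuperOp V)) (h𝔼 : IsNProg V 𝔼) (h𝔽 : IsNProg V 𝔽) :
    ((wp Finset.subset_union_left 𝔼 {Omega b b'}, {Omega b b'}) ∈ SpecS (V ∪ V') ∧
      (RefinesTot 𝔼 𝔽 ↔
        SatTot 𝔽 (wp Finset.subset_union_left 𝔼 {Omega b b'}, {Omega b b'}))) ∧
    ((wlp Finset.subset_union_left 𝔼 {1 - Omega b b'}, {1 - Omega b b'}) ∈ SpecS (V ∪ V') ∧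
      (RefinesPar 𝔼 𝔽 ↔
        SatPar 𝔽 (wlp Finset.subset_union_left 𝔼 {1 - Omega b b'}, {1 - Omega b b'}))) := by
  have hΩ := Omega_mem_effects b b' hV'.2
  have hT : (wp Finset.subset_union_left 𝔼 {Omega b b'}, {Omega b b'}) ∈ SpecS (V ∪ V') :=
    ⟨wp_subset_effects _ h𝔼 hΩ, Set.singleton_subset_iff.2 hΩ⟩
  have hP : (wlp Finset.subset_union_left 𝔼 {1 - Omega b b'}, {1 - Omega b b'}) ∈
      SpecS (V ∪ V') :=
    ⟨wlp_subset_effects _ h𝔼 hΩ, Set.singleton_subset_iff.2 (one_sub_mem_effects hΩ)⟩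
  refine ⟨⟨hT, fun h => h _ _ hT (satTot_wp _ h𝔼 hΩ), fun h => ?_⟩,
    ⟨hP, fun h => h _ _ hP (satPar_wlp _ h𝔼 hΩ), fun h => ?_⟩⟩
  · refine refinesTot_of_forall_exists_le h𝔼 h𝔽 fun F hF => ?_
    obtain ⟨E, hE, hEF⟩ := exists_adjointSuper_le_of_satTot _ h𝔼 h𝔽 hΩ h hF
    exact ⟨E, hE, fun X hX ρ hρ =>
      extendSuper_posSemidef_of_adjointSuper_Omega b b' hV'.2 hEF hX hρ⟩
  · refine refinesPar_of_forall_exists_ge h𝔼 h𝔽 fun F hF => ?_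
    obtain ⟨E, hE, hEF⟩ := exists_adjointSuper_ge_of_satPar _ h𝔼 h𝔽 hΩ h hF
    exact ⟨E, hE, fun X hX ρ hρ =>
      extendSuper_posSemidef_of_adjointSuper_Omega b b' hV'.2 hEF hX hρ⟩
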